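/- Let $\mathcal{M}_k$ be the algebra of complex $k\times k$ matrices and $\vartheta_k:\mathcal{M}_k\to\mathcal{M}_k$, $\vartheta_k(X)=X^T$. A linear map $P:\mathcal{M}_{d_A}\to\mathcal{M}_{d_B}$ is positive if it maps positive semidefinite matrices to positive semidefinite matrices, completely positive if $\mathrm{id}_k\otimes P$ is positive for every $k\in\mathbb{N}$, and decomposable if $P=T_1+\vartheta\circ T_2$ with $T_1,T_2$ completely positive and $\vartheta$ the transposition on the target algebra. Its Choi matrix is $C_P=\sum_{i,j=1}^{d_A}|i\rangle\langle j|\otimes P(|i\rangle\langle j|)$. For a non-zero positive map $P$ put \[ \mu(P)=\inf\left\{\frac{\mathrm{Tr}[C_PC_T]}{\mathrm{Tr}[(T^*\circ P)(\mathbb{1}_{d_A})]}\ \middle|\ T:\mathcal{M}_{d_A}\to\mathcal{M}_{d_B}\text{ completely positive},\ (T^*\circ P)(\mathbb{1}_{d_A})\neq 0\right\}, \] where $T^*$ is the adjoint of $T$ with respect to the Hilbert–Schmidt inner products $\langle X,Y\rangle=\mathrm{Tr}[X^\dagger Y]$. Theorem. Let $P:\mathcal{M}_{d_A}\to\mathcal{M}_{d_B}$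 be a non-zero positive map, let $d=\min(d_A,d_B)$, and let $n\ge 2$ be an integer. If $P^{\otimes n}:\mathcal{M}_{d_A}^{\otimes n}\to\mathcal{M}_{d_B}^{\otimes n}$ is decomposable, then \[ \max\bigl(\mu(P),\mu(\vartheta_{d_B}\circ P)\bigr)\ \ge\ \frac{2}{1+\Bigl(1+\sqrt{\tfrac{2d}{d+1}}\Bigr)^{1/\lfloor n/2\rfloor}}-1, \] where $\lfloor x\rfloor$ is the largest integer less than or equal to $x$. -/

import Mathlib

open scoped Matrix Kronecker ComplexOrder

namespace TensorStable

variable {A B : Type*}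

/-- A linear map between matrix algebras is positive if it maps positive semidefinite matrices to
positive semidefinite matrices. -/
def IsPositive (P : Matrix A A ℂ →ₗ[ℂ] Matrix B B ℂ) : Prop :=
  ∀ X : Matrix A A ℂ, X.PosSemidef → (P X).PosSemidef

/-- The map `id ⊗ L` on `M_K ⊗ M_A`, realised as the matrices indexed by `K × A`:
`L` is applied to every `A`-block. -/
def idTensor (K : Type*) (L : Matrix A A ℂ →ₗ[ℂ] Matrix B B ℂ) :
    Matrix (K × A) (K × A) ℂ →ₗ[ℂ] Matrix (K × B) (K × B) ℂ where
  toFun X := Matrix.of fun p q => L (Matrix.of fun a a' => X (p.1, a) (q.1, a')) p.2 q.2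
  map_add' X Y := by
    ext p q
    exact congrFun (congrFun (L.map_add (Matrix.of fun a a' => X (p.1, a) (q.1, a'))
      (Matrix.of fun a a' => Y (p.1, a) (q.1, a'))) p.2) q.2
  map_smul' c X := by
    ext p q
    exact congrFun (congrFun (L.map_smul c (Matrix.of fun a a' => X (p.1, a) (q.1, a'))) p.2) q.2

/-- Complete positivity: `id_k ⊗ T` is positive for every `k`. -/
def IsCompletelyPositive (T : Matrix A A ℂ →ₗ[ℂ] Matrix B B ℂ) : Prop :=
  ∀ k : ℕ, IsPositive (idTensor (Fin k) T)

/-- The transposition `X ↦ Xᵀ` in the computational basis. -/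
def transposition (B : Type*) : Matrix B B ℂ →ₗ[ℂ] Matrix B B ℂ :=
  (Matrix.transposeLinearEquiv B B ℂ ℂ).toLinearMap

/-- Decomposable maps: sums `T₁ + ϑ ∘ T₂` with `T₁`, `T₂` completely positive. -/
def IsDecomposable (P : Matrix A A ℂ →ₗ[ℂ] Matrix B B ℂ) : Prop :=
  ∃ T₁ T₂ : Matrix A A ℂ →ₗ[ℂ] Matrix B B ℂ,
    IsCompletelyPositive T₁ ∧ IsCompletelyPositive T₂ ∧ P = T₁ + transposition B ∘ₗ T₂

/-- The elementary tensor `X₀ ⊗ ⋯ ⊗ Xₙ₋₁`, where `M_A^{⊗ n}` is realised as the matrices indexed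
by `Fin n → A` (product of the computational bases). -/
def elementaryTensor {n : ℕ} (X : Fin n → Matrix A A ℂ) :
    Matrix (Fin n → A) (Fin n → A) ℂ :=
  Matrix.of fun a a' => ∏ i, X i (a i) (a' i)

/-- The tensor power `P^{⊗ n}`, given by its values on matrix units
(see `tensorPower_elementaryTensor`). -/
def tensorPower [Fintype A] [DecidableEq A] (n : ℕ) (P : Matrix A A ℂ →ₗ[ℂ] Matrix B B ℂ) :
    Matrix (Fin n → A) (Fin n → A) ℂ →ₗ[ℂ] Matrix (Fin n → B) (Fin n → B) ℂ where
  toFun X := ∑ a, ∑ a', X a a' • elementaryTensor fun i => P (Matrix.single (a i) (a' i) 1)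
  map_add' X Y := by
    simp only [Matrix.add_apply, add_smul, Finset.sum_add_distrib]
  map_smul' c X := by
    simp only [Matrix.smul_apply, smul_eq_mul, mul_smul, Finset.smul_sum, RingHom.id_apply]

/-- `P` is `n`-tensor-stable decomposable if `P^{⊗ n}` is decomposable. -/
def IsTensorStableDecomposable [Fintype A] [DecidableEq A] (n : ℕ) (P : Matrix A A ℂ →ₗ[ℂ] Matrix B B ℂ) : Prop :=
  IsDecomposable (tensorPower n P)

/-- The unnormalised maximally entangled state `ω = |Ω⟩⟨Ω|`, `|Ω⟩ = ∑ᵢ |i⟩ ⊗ |i⟩`. -/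
def maxEntangled (A : Type*) [DecidableEq A] : Matrix (A × A) (A × A) ℂ :=
  Matrix.vecMulVec (fun p => if p.1 = p.2 then 1 else 0) (fun p => if p.1 = p.2 then 1 else 0)

/-- The Choi matrix `C_L = (id ⊗ L)(ω)`. -/
def choi [DecidableEq A] (L : Matrix A A ℂ →ₗ[ℂ] Matrix B B ℂ) : Matrix (A × B) (A × B) ℂ :=
  idTensor A L (maxEntangled A)

/-- The adjoint of `T` for the Hilbert–Schmidt inner products `⟨X, Y⟩ = Tr[Xᴴ Y]`: its `(i, j)`
entry at `Y` is `⟨T(Eᵢⱼ), Y⟩` (see `hsAdjoint_spec`). -/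
def hsAdjoint [DecidableEq A] [Fintype B] (T : Matrix A A ℂ →ₗ[ℂ] Matrix B B ℂ) : Matrix B B ℂ →ₗ[ℂ] Matrix A A ℂ where
  toFun Y := Matrix.of fun i j => ((T (Matrix.single i j 1))ᴴ * Y).trace
  map_add' X Y := by
    ext i j
    simp [Matrix.mul_add]
  map_smul' c X := by
    ext i j
    simp

/-- The quantity `μ(P)`: the infimum of `Tr[C_P C_T] / Tr[(T* ∘ P)(1)]` over all completely
positive `T` with `(T* ∘ P)(1) ≠ 0`. For positive `P` both traces are real, so the real parts
lose nothing. The infimum is taken in the extended reals, where it needs no side condition. -/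
noncomputable def mu [Fintype A] [DecidableEq A] [Fintype B] (P : Matrix A A ℂ →ₗ[ℂ] Matrix B B ℂ) : EReal :=
  sInf {r : EReal | ∃ T : Matrix A A ℂ →ₗ[ℂ] Matrix B B ℂ,
    IsCompletelyPositive T ∧ (hsAdjoint T ∘ₗ P) 1 ≠ 0 ∧
      r = (((choi P * choi T).trace.re / ((hsAdjoint T ∘ₗ P) 1).trace.re : ℝ) : EReal)}

theorem idTensor_kronecker {K : Type*} (L : Matrix A A ℂ →ₗ[ℂ] Matrix B B ℂ)
    (X : Matrix K K ℂ) (Y : Matrix A A ℂ) : idTensor K L (X ⊗ₖ Y) = X ⊗ₖ L Y := by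
  ext p q
  exact congrFun (congrFun (L.map_smul (X p.1 q.1) Y) p.2) q.2

theorem map_eq_sum [Fintype A] [DecidableEq A] (P : Matrix A A ℂ →ₗ[ℂ] Matrix B B ℂ) (X : Matrix A A ℂ) :
    P X = ∑ a, ∑ a', X a a' • P (Matrix.single a a' 1) := by
  conv_lhs => rw [Matrix.matrix_eq_sum_single X]
  simp only [map_sum, ← map_smul, Matrix.smul_single, smul_eq_mul, mul_one]

theorem hsAdjoint_spec [Fintype A] [DecidableEq A] [Fintype B] (T : Matrix A A ℂ →ₗ[ℂ] Matrix B B ℂ) (X : Matrix A A ℂ)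
    (Y : Matrix B B ℂ) : ((T X)ᴴ * Y).trace = (Xᴴ * hsAdjoint T Y).trace := by
  rw [map_eq_sum T X]
  simp only [Matrix.conjTranspose_sum, Matrix.conjTranspose_smul, Finset.sum_mul,
    Matrix.trace_sum, Matrix.smul_mul, Matrix.trace_smul]
  rw [Finset.sum_comm]
  simp [Matrix.trace, Matrix.mul_apply, hsAdjoint]

theorem tensorPower_elementaryTensor [Fintype A] [DecidableEq A] (n : ℕ) (P : Matrix A A ℂ →ₗ[ℂ] Matrix B B ℂ)
    (X : Fin n → Matrix A A ℂ) :
    tensorPower n P (elementaryTensor X) = elementaryTensor fun i => P (X i) := by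
  ext b b'
  have h : ∀ i, P (X i) (b i) (b' i) =
      ∑ a, ∑ a', X i a a' * P (Matrix.single a a' 1) (b i) (b' i) := fun i => by
    conv_lhs => rw [map_eq_sum P (X i)]
    simp [Matrix.sum_apply]
  simp only [elementaryTensor, tensorPower, LinearMap.coe_mk, AddHom.coe_mk, Matrix.of_apply,
    Matrix.sum_apply, Matrix.smul_apply, smul_eq_mul, h, Fintype.prod_sum, Finset.prod_mul_distrib]

end TensorStable

namespace TensorStable

variable {A B : Type*}

/-! Write C = `choi P`, Γ for partial transposition, k = ⌊n/2⌋ and s^k = 1 + √(2d/(d+1)), so that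
the bound reads -(s-1)/(s+1). If both values of μ lie below it, there are positive semidefinite H,
H' such that, with G = 1 ⊗ Tr_A H and G' likewise, a = Tr[C(G+H)] and b = Tr[C(G-H)] satisfy 0 ≤ a
and s a < b, and so do a', b' formed with C^Γ (`exists_isTestPair_of_mu_lt`).

The Choi matrix of a decomposable map has nonnegative trace against every positive semidefinite
matrix with positive semidefinite partial transpose. With δ = (d-1)/(d+1), such a matrix (`witness`)
is δ (G+H)(G'+H')^Γ + (G-H)(G'+H')^Γ + (G+H)(G'-H')^Γ - (G-H)(G'-H')^Γ, where each bracket stands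
for its k-th tensor power, products are tensor products, and 1 fills the leftover factor for odd n.
Its positivity rests on H ≤ dG and (G' ± H')^Γ ≥ 0 (`isTestPair_of_posSemidef`,
`posSemidef_witness`); Γ merely exchanges the two halves.

Against C^{⊗n} it gives Tr[C]^(n-2k) times (1+δ) a^k a'^k - (b^k - a^k)(b'^k - a'^k), which is
negative because 1+δ = 2d/(d+1) (`combination_neg`). -/

/-! ### Trace versus Frobenius norm. -/

theorem sum_norm_sq_eq_trace {m n : Type*} [Fintype m] [Fintype n] (M : Matrix m n ℂ) :
    ((∑ a, ∑ b, ‖M a b‖ ^ 2 : ℝ) : ℂ) = (Mᴴ * M).trace := by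
  rw [Finset.sum_comm]
  simp only [Matrix.trace, Matrix.diag_apply, Matrix.mul_apply, Matrix.conjTranspose_apply]
  push_cast
  exact Finset.sum_congr rfl fun b _ => Finset.sum_congr rfl fun a _ =>
    (Complex.conj_mul' (M a b)).symm

theorem norm_sum_sq_le_card_mul {ι : Type*} [Fintype ι] (f : ι → ℂ) :
    ‖∑ i, f i‖ ^ 2 ≤ Fintype.card ι * ∑ i, ‖f i‖ ^ 2 :=
  (pow_le_pow_left₀ (norm_nonneg _) (norm_sum_le _ _) 2).trans
    (by simpa using sq_sum_le_card_mul_sum_sq (s := Finset.univ) (f := fun i => ‖f i‖))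

theorem norm_trace_sq_le [Fintype A] (M : Matrix A A ℂ) :
    ‖M.trace‖ ^ 2 ≤ Fintype.card A * ∑ a, ∑ a', ‖M a a'‖ ^ 2 := by
  refine (norm_sum_sq_le_card_mul fun a => M a a).trans ?_
  gcongr with a
  exact Finset.single_le_sum (f := fun a' => ‖M a a'‖ ^ 2) (fun _ _ => by positivity)
    (Finset.mem_univ a)

theorem norm_sum_mul_sq_le {ι : Type*} [Fintype ι] (f g : ι → ℂ) :
    ‖∑ i, f i * g i‖ ^ 2 ≤ (∑ i, ‖f i‖ ^ 2) * ∑ i, ‖g i‖ ^ 2 := by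
  refine (pow_le_pow_left₀ (norm_nonneg _) (norm_sum_le _ _) 2).trans ?_
  simp only [norm_mul]
  exact Finset.sum_mul_sq_le_sq_mul_sq _ _ _

/-- Diagonalise Xᴴ X by a unitary U and insert U Uᴴ between the factors. -/
theorem exists_mul_eq_with_orthogonal_columns [Fintype A] [Fintype B] [DecidableEq B]
    (X : Matrix A B ℂ) (Y : Matrix B A ℂ) :
    ∃ (X' : Matrix A B ℂ) (Y' : Matrix B A ℂ) (D : B → ℂ),
      X' * Y' = X * Y ∧ X'ᴴ * X' = Matrix.diagonal D := by
  have hH : (Xᴴ * X).IsHermitian := Matrix.isHermitian_conjTranspose_mul_self X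
  obtain ⟨U, D, hU, hU', hs⟩ : ∃ (U : Matrix B B ℂ) (D : B → ℂ), U * Uᴴ = 1 ∧ Uᴴ * U = 1 ∧
      Xᴴ * X = U * Matrix.diagonal D * Uᴴ := by
    refine ⟨hH.eigenvectorUnitary.1, RCLike.ofReal ∘ hH.eigenvalues,
      Matrix.mem_unitaryGroup_iff.mp hH.eigenvectorUnitary.2,
      Matrix.mem_unitaryGroup_iff'.mp hH.eigenvectorUnitary.2, ?_⟩
    conv_lhs => rw [hH.spectral_theorem, Unitary.conjStarAlgAut_apply]
    rfl
  refine ⟨X * U, Uᴴ * Y, D, ?_, ?_⟩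
  · rw [Matrix.mul_assoc, ← Matrix.mul_assoc U, hU, Matrix.one_mul]
  · rw [Matrix.conjTranspose_mul, Matrix.mul_assoc, ← Matrix.mul_assoc Xᴴ, hs]
    simp only [Matrix.mul_assoc, hU', Matrix.mul_one]
    rw [← Matrix.mul_assoc, hU', Matrix.one_mul]

/-- The rank of a product `X * Y` is bounded by its inner dimension, whence this strengthening of
`norm_trace_sq_le`. -/
theorem norm_trace_mul_sq_le [Fintype A] [Fintype B] [DecidableEq B]
    (X : Matrix A B ℂ) (Y : Matrix B A ℂ) :
    ‖(X * Y).trace‖ ^ 2 ≤ Fintype.card B * ∑ a, ∑ a', ‖(X * Y) a a'‖ ^ 2 := by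
  obtain ⟨X', Y', D, hXY, hD⟩ := exists_mul_eq_with_orthogonal_columns X Y
  rw [← hXY]
  have hDj : ∀ j, ((∑ a, ‖X' a j‖ ^ 2 : ℝ) : ℂ) = D j := fun j => by
    have h := congrFun (congrFun hD j) j
    rw [Matrix.diagonal_apply_eq] at h
    rw [← h, Matrix.mul_apply]
    push_cast
    exact Finset.sum_congr rfl fun a _ => (Complex.conj_mul' (X' a j)).symm
  -- The columns of X' are orthogonal, so the cross terms between the rank-one summands of X' Y'
  -- vanish.
  have hF : ∑ a, ∑ a', ‖(X' * Y') a a'‖ ^ 2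
      = ∑ j, (∑ a, ‖X' a j‖ ^ 2) * ∑ a, ‖Y' j a‖ ^ 2 := by
    apply Complex.ofReal_injective
    rw [sum_norm_sq_eq_trace, Matrix.conjTranspose_mul, Matrix.mul_assoc, ← Matrix.mul_assoc X'ᴴ,
      hD, Matrix.trace_mul_comm]
    push_cast
    rw [Matrix.trace]
    refine Finset.sum_congr rfl fun j _ => ?_
    rw [Matrix.diag_apply, Matrix.mul_apply, Finset.mul_sum]
    refine Finset.sum_congr rfl fun a _ => ?_
    rw [Matrix.diagonal_mul, Matrix.conjTranspose_apply, ← hDj, mul_assoc, ← Complex.mul_conj']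
    push_cast
    rfl
  have hT : (X' * Y').trace = ∑ j, ∑ a, X' a j * Y' j a := by
    simp only [Matrix.trace, Matrix.diag_apply, Matrix.mul_apply]
    exact Finset.sum_comm
  rw [hF, hT]
  refine (norm_sum_sq_le_card_mul _).trans ?_
  gcongr with j
  exact norm_sum_mul_sq_le _ _

/-! ### Partial transposition and test pairs. -/

/-- The partial transposition on the second tensor factor. -/
def partialTranspose (X : Matrix (A × B) (A × B) ℂ) : Matrix (A × B) (A × B) ℂ :=
  Matrix.of fun p q => X (p.1, q.2) (q.1, p.2)

/-- The partial trace over the first tensor factor. -/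
def partialTrace [Fintype A] (X : Matrix (A × B) (A × B) ℂ) : Matrix B B ℂ :=
  Matrix.of fun b b' => ∑ a, X (a, b) (a, b')

/-- The properties of `(1, ω)` which are inherited by `(1 ⊗ Tr_A C, C)` for positive semidefinite
`C`. -/
structure IsTestPair (r : ℝ) (G H : Matrix (A × B) (A × B) ℂ) : Prop where
  posSemidef_right : H.PosSemidef
  posSemidef_sub : ((r : ℂ) • G - H).PosSemidef
  posSemidef_left : G.PosSemidef
  posSemidef_partialTranspose_left : (partialTranspose G).PosSemidef
  posSemidef_partialTranspose_add : (partialTranspose (G + H)).PosSemidef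
  posSemidef_partialTranspose_sub : (partialTranspose (G - H)).PosSemidef

theorem partialTranspose_add (X Y : Matrix (A × B) (A × B) ℂ) :
    partialTranspose (X + Y) = partialTranspose X + partialTranspose Y := rfl

theorem partialTranspose_sub (X Y : Matrix (A × B) (A × B) ℂ) :
    partialTranspose (X - Y) = partialTranspose X - partialTranspose Y := rfl

theorem partialTranspose_smul (c : ℂ) (X : Matrix (A × B) (A × B) ℂ) :
    partialTranspose (c • X) = c • partialTranspose X := rfl

theorem partialTranspose_partialTranspose (X : Matrix (A × B) (A × B) ℂ) :
    partialTranspose (partialTranspose X) = X := rfl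

theorem partialTranspose_one_kronecker [DecidableEq A] (N : Matrix B B ℂ) :
    partialTranspose ((1 : Matrix A A ℂ) ⊗ₖ N) = (1 : Matrix A A ℂ) ⊗ₖ Nᵀ := rfl

theorem trace_partialTranspose_mul [Fintype A] [Fintype B] (X Y : Matrix (A × B) (A × B) ℂ) :
    (partialTranspose X * Y).trace = (X * partialTranspose Y).trace := by
  simp only [Matrix.trace, Matrix.diag_apply, Matrix.mul_apply, partialTranspose, Matrix.of_apply,
    Fintype.sum_prod_type]
  refine Finset.sum_congr rfl fun a _ => ?_
  rw [Finset.sum_comm, Finset.sum_comm (s := Finset.univ (α := B))]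
  refine Finset.sum_congr rfl fun a' _ => ?_
  exact Finset.sum_comm

theorem posSemidef_partialTrace [Fintype A] {C : Matrix (A × B) (A × B) ℂ} (hC : C.PosSemidef) :
    (partialTrace C).PosSemidef := by
  have h : partialTrace C = ∑ a, C.submatrix (fun b => (a, b)) (fun b => (a, b)) := by
    ext b b'
    simp [partialTrace, Matrix.sum_apply]
  rw [h]
  exact Matrix.posSemidef_sum _ fun a _ => hC.submatrix _

theorem star_dotProduct_vecMulVec_mulVec [Fintype A] [Fintype B] (v x : A × B → ℂ) :
    star x ⬝ᵥ (Matrix.vecMulVec v (star v) *ᵥ x)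
      = ((‖∑ a, ∑ b, star (v (a, b)) * x (a, b)‖ ^ 2 : ℝ) : ℂ) := by
  have h : star v ⬝ᵥ x = ∑ a, ∑ b, star (v (a, b)) * x (a, b) := by
    simp [dotProduct, Fintype.sum_prod_type]
  have h' : star x ⬝ᵥ v = star (star v ⬝ᵥ x) := by
    rw [Matrix.star_dotProduct]
  rw [Matrix.vecMulVec_mulVec, dotProduct_smul, ← h, h', Complex.ofReal_pow, ← Complex.conj_mul']
  rfl

/-- The Kronecker product is a Gram matrix Lᴴ L. The form is the squared Frobenius norm of the
matrix whose trace appears in `star_dotProduct_vecMulVec_mulVec`. -/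
theorem star_dotProduct_one_kronecker_partialTrace_mulVec [Fintype A] [Fintype B] [DecidableEq A]
    (v x : A × B → ℂ) :
    star x ⬝ᵥ (((1 : Matrix A A ℂ) ⊗ₖ partialTrace (Matrix.vecMulVec v (star v))) *ᵥ x)
      = ((∑ a', ∑ a, ‖∑ b, star (v (a', b)) * x (a, b)‖ ^ 2 : ℝ) : ℂ) := by
  let L : Matrix (A × A) (A × B) ℂ :=
    Matrix.of fun p q => if p.2 = q.1 then star (v (p.1, q.2)) else 0
  have hL : (1 : Matrix A A ℂ) ⊗ₖ partialTrace (Matrix.vecMulVec v (star v)) = Lᴴ * L := by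
    ext p q
    simp only [L, Matrix.kroneckerMap_apply, partialTrace, Matrix.mul_apply,
      Matrix.conjTranspose_apply, Matrix.of_apply, Fintype.sum_prod_type, Matrix.vecMulVec_apply,
      Matrix.one_apply, Pi.star_apply]
    by_cases h : p.1 = q.1
    · simp [h, apply_ite star]
    · simp [h, Ne.symm h, apply_ite star]
  have hLx : ∀ p, (L *ᵥ x) p = ∑ b, star (v (p.1, b)) * x (p.2, b) := fun p => by
    simp [L, Matrix.mulVec, dotProduct, Fintype.sum_prod_type, Finset.sum_ite_irrel]
  rw [hL, ← Matrix.mulVec_mulVec, Matrix.dotProduct_mulVec, ← Matrix.star_mulVec]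
  simp only [dotProduct, Pi.star_apply, hLx, Fintype.sum_prod_type]
  push_cast
  simp only [← Complex.conj_mul']
  rfl

/-- The model case is v = Ω, where the claims become ω ≤ d 1 and 1 ± F ≥ 0 with F the flip. -/
theorem isTestPair_vecMulVec [Fintype A] [Fintype B] [DecidableEq A] [DecidableEq B]
    (v : A × B → ℂ) :
    IsTestPair (min (Fintype.card A) (Fintype.card B) : ℕ)
      ((1 : Matrix A A ℂ) ⊗ₖ partialTrace (Matrix.vecMulVec v (star v)))
      (Matrix.vecMulVec v (star v)) := by
  set H := Matrix.vecMulVec v (star v)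
  set N := partialTrace H with hN
  have hH : H.PosSemidef := Matrix.posSemidef_vecMulVec_self_star v
  have hNpos : N.PosSemidef := posSemidef_partialTrace hH
  have hG : ((1 : Matrix A A ℂ) ⊗ₖ N).PosSemidef := Matrix.PosSemidef.one.kronecker hNpos
  have hGram : ∀ ε : ℝ, ε ^ 2 = 1 →
      (partialTranspose ((1 : Matrix A A ℂ) ⊗ₖ N) + (ε : ℂ) • partialTranspose H).PosSemidef := by
    intro ε hε
    -- M is 1 + εF, with F the flip on A × A, after the contraction of the B index with v. As ε² =
    -- 1, (1 + εF)² = 2(1 + εF), whence the factor 1/2.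
    let M : Matrix (A × A) (A × B) ℂ := Matrix.of fun p q =>
      (if p.1 = q.1 then v (p.2, q.2) else 0) + ε * (if p.2 = q.1 then v (p.1, q.2) else 0)
    have hM : partialTranspose ((1 : Matrix A A ℂ) ⊗ₖ N) + (ε : ℂ) • partialTranspose H
        = (1 / 2 : ℂ) • (Mᴴ * M) := by
      have hε' : (ε : ℂ) * ε = 1 := by rw [← sq]; exact_mod_cast hε
      ext p q
      simp only [M, H, hN, Matrix.add_apply, Matrix.smul_apply, partialTranspose, partialTrace,
        Matrix.kroneckerMap_apply, Matrix.mul_apply, smul_eq_mul,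
        Matrix.conjTranspose_apply, Matrix.of_apply, Fintype.sum_prod_type, Matrix.vecMulVec_apply,
        Matrix.one_apply, Pi.star_apply]
      simp only [star_add, star_mul', apply_ite star, star_zero, add_mul, mul_add,
        Finset.sum_add_distrib, mul_ite, ite_mul, mul_zero, zero_mul]
      have hε'' : star (ε : ℂ) = ε := Complex.conj_ofReal ε
      simp only [Finset.sum_ite_irrel, Finset.sum_const_zero, Finset.sum_ite_eq', Finset.mem_univ,
        if_true, Finset.sum_add_distrib, hε'', eq_comm (a := q.1)]
      have h1 : ∑ a, v (a, q.2) * star (v (a, p.2)) = ∑ a, star (v (a, p.2)) * v (a, q.2) :=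
        Finset.sum_congr rfl fun a _ => mul_comm _ _
      have h2 : ∑ a, (ε : ℂ) * star (v (a, p.2)) * (ε * v (a, q.2))
          = ∑ a, star (v (a, p.2)) * v (a, q.2) :=
        Finset.sum_congr rfl fun a _ => by
          rw [← mul_assoc, mul_right_comm (ε : ℂ), hε', one_mul]
      rw [h1, h2]
      split_ifs <;> ring
    rw [hM]
    exact (Matrix.posSemidef_conjTranspose_mul_self M).smul
      (by rw [Complex.nonneg_iff]; norm_num)
  refine ⟨hH, ?_, hG, ?_, ?_, ?_⟩
  · refine Matrix.PosSemidef.of_dotProduct_mulVec_nonneg ?_ fun x => ?_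
    · refine Matrix.IsHermitian.sub ?_ hH.1
      exact (hG.smul (a := (((min (Fintype.card A) (Fintype.card B) : ℕ) : ℝ) : ℂ))
        (by simp)).1
    · let X : Matrix A B ℂ := Matrix.of fun a b => star (v (a, b))
      let Y : Matrix B A ℂ := Matrix.of fun b a => x (a, b)
      have h1 := norm_trace_sq_le (X * Y)
      have h2 := norm_trace_mul_sq_le X Y
      have h3 : ‖(X * Y).trace‖ ^ 2 ≤ (min (Fintype.card A) (Fintype.card B) : ℕ) *
          ∑ a, ∑ a', ‖(X * Y) a a'‖ ^ 2 := by
        rcases min_choice (Fintype.card A) (Fintype.card B) with h | h <;> rw [h] <;> assumption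
      rw [Matrix.sub_mulVec, dotProduct_sub, Matrix.smul_mulVec, dotProduct_smul,
        star_dotProduct_vecMulVec_mulVec, star_dotProduct_one_kronecker_partialTrace_mulVec,
        smul_eq_mul, ← Complex.ofReal_mul, ← Complex.ofReal_sub, Complex.zero_le_real, sub_nonneg]
      exact h3
  · rw [partialTranspose_one_kronecker]
    exact Matrix.PosSemidef.one.kronecker hNpos.transpose
  · have h := hGram 1 (by norm_num)
    rwa [Complex.ofReal_one, one_smul] at h
  · have h := hGram (-1) (by norm_num)
    rwa [Complex.ofReal_neg, Complex.ofReal_one, neg_one_smul, ← sub_eq_add_neg] at h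

theorem isTestPair_zero (r : ℝ) : IsTestPair r (0 : Matrix (A × B) (A × B) ℂ) 0 := by
  have h : (partialTranspose (0 : Matrix (A × B) (A × B) ℂ)).PosSemidef := Matrix.PosSemidef.zero
  exact ⟨.zero, by simpa using .zero, .zero, h, by simpa using h, by simpa using h⟩

theorem IsTestPair.add {r : ℝ} {G H G' H' : Matrix (A × B) (A × B) ℂ} (h : IsTestPair r G H)
    (h' : IsTestPair r G' H') : IsTestPair r (G + G') (H + H') where
  posSemidef_right := h.1.add h'.1
  posSemidef_sub := by
    rw [smul_add, add_sub_add_comm]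
    exact h.2.add h'.2
  posSemidef_left := h.3.add h'.3
  posSemidef_partialTranspose_left := h.4.add h'.4
  posSemidef_partialTranspose_add := by
    rw [add_add_add_comm]
    exact h.5.add h'.5
  posSemidef_partialTranspose_sub := by
    rw [add_sub_add_comm]
    exact h.6.add h'.6

theorem partialTrace_add [Fintype A] (X Y : Matrix (A × B) (A × B) ℂ) :
    partialTrace (X + Y) = partialTrace X + partialTrace Y := by
  ext b b'
  simp [partialTrace, Finset.sum_add_distrib]

theorem isTestPair_of_posSemidef [Fintype A] [Fintype B] [DecidableEq A] [DecidableEq B]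
    {C : Matrix (A × B) (A × B) ℂ} (hC : C.PosSemidef) :
    IsTestPair (min (Fintype.card A) (Fintype.card B) : ℕ)
      ((1 : Matrix A A ℂ) ⊗ₖ partialTrace C) C := by
  obtain ⟨m, v, rfl⟩ := Matrix.posSemidef_iff_eq_sum_vecMulVec.mp hC
  clear hC
  generalize (Finset.univ : Finset (Fin m)) = s
  induction s using Finset.cons_induction with
  | empty =>
    have h : partialTrace (0 : Matrix (A × B) (A × B) ℂ) = 0 := by
      ext b b'
      simp [partialTrace]
    simpa [h] using isTestPair_zero (A := A) (B := B) _
  | cons i s hi ih =>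
    rw [Finset.sum_cons, partialTrace_add, Matrix.kronecker_add]
    exact (isTestPair_vecMulVec (v i)).add ih

/-! ### Positivity of combinations of tensor powers. -/

theorem trace_elementaryTensor {n : ℕ} [Fintype A] [DecidableEq A]
    (X : Fin n → Matrix A A ℂ) : (elementaryTensor X).trace = ∏ i, (X i).trace := by
  simp only [Matrix.trace, Matrix.diag_apply, elementaryTensor, Matrix.of_apply, Fintype.prod_sum]

theorem elementaryTensor_mul {n : ℕ} [Fintype A] [DecidableEq A] (X Y : Fin n → Matrix A A ℂ) :
    elementaryTensor X * elementaryTensor Y = elementaryTensor fun i => X i * Y i := by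
  ext a a'
  simp only [Matrix.mul_apply, elementaryTensor, Matrix.of_apply, Fintype.prod_sum,
    Finset.prod_mul_distrib]

theorem conjTranspose_elementaryTensor {n : ℕ} (X : Fin n → Matrix A A ℂ) :
    (elementaryTensor X)ᴴ = elementaryTensor fun i => (X i)ᴴ := by
  ext a a'
  simp [elementaryTensor]

theorem posSemidef_elementaryTensor {n : ℕ} [Fintype A] [DecidableEq A]
    {X : Fin n → Matrix A A ℂ} (hX : ∀ i, (X i).PosSemidef) :
    (elementaryTensor X).PosSemidef := by
  have h : ∀ i, ∃ Y : Matrix A A ℂ, X i = Yᴴ * Y := fun i => by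
    open scoped MatrixOrder in
    exact CStarAlgebra.nonneg_iff_eq_star_mul_self.mp (hX i).nonneg
  choose Y hY using h
  rw [funext hY, ← elementaryTensor_mul, ← conjTranspose_elementaryTensor]
  exact Matrix.posSemidef_conjTranspose_mul_self _

theorem elementaryTensor_add_smul {n : ℕ} (X Q : Fin n → Matrix A A ℂ) (t : ℂ) :
    elementaryTensor (fun i => X i + t • Q i)
      = ∑ S : Finset (Fin n), t ^ S.card • elementaryTensor fun i => if i ∈ S then Q i else X i := by
  ext a a'
  simp only [Matrix.sum_apply, Matrix.smul_apply, elementaryTensor, Matrix.of_apply,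
    Matrix.add_apply, smul_eq_mul]
  simp_rw [add_comm (X _ _ _)]
  rw [Finset.prod_add, Finset.powerset_univ]
  refine Finset.sum_congr rfl fun S _ => ?_
  rw [Finset.prod_mul_distrib, Finset.prod_const, mul_assoc]
  congr 1
  rw [← Finset.prod_mul_prod_compl S, ← Finset.compl_eq_univ_sdiff]
  refine congrArg₂ _ (Finset.prod_congr rfl fun i hi => ?_) (Finset.prod_congr rfl fun i hi => ?_)
  · rw [if_pos hi]
  · rw [if_neg (Finset.mem_compl.mp hi)]

theorem one_add_pow_sub_nonneg {r : ℝ} (hr : 1 ≤ r) (j : ℕ) : 0 ≤ (1 + r) ^ j - (1 - r) ^ j := by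
  have h : |1 - r| ≤ 1 + r := by rw [abs_le]; constructor <;> linarith
  have h2 := pow_le_pow_left₀ (abs_nonneg _) h j
  have h3 := (le_abs_self ((1 - r) ^ j)).trans_eq (abs_pow _ _)
  linarith

/-- Equality holds at j = 1, so (r-1)/(r+1) is the least admissible constant. -/
theorem one_add_pow_add_nonneg {r : ℝ} (hr : 1 ≤ r) (j : ℕ) :
    0 ≤ (r - 1) / (r + 1) * (1 + r) ^ j + (1 - r) ^ j := by
  cases j with
  | zero =>
    have : 0 ≤ (r - 1) / (r + 1) := div_nonneg (by linarith) (by linarith)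
    simp only [pow_zero, mul_one]
    linarith
  | succ j =>
    have h : (r - 1) / (r + 1) * (1 + r) ^ (j + 1) + (1 - r) ^ (j + 1)
        = (r - 1) * ((1 + r) ^ j - (1 - r) ^ j) := by
      have : r + 1 ≠ 0 := by linarith
      field_simp
      ring
    rw [h]
    exact mul_nonneg (by linarith) (one_add_pow_sub_nonneg hr j)

/-- Expand over the set S of positions occupied by Q: the terms with X and those with Y carry
exactly the coefficients of the two preceding inequalities, with j = |S|. -/
theorem posSemidef_elementaryTensor_combination {n : ℕ} [Fintype A] [DecidableEq A] {r : ℝ}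
    (hr : 1 ≤ r) {Q X Y : Fin n → Matrix A A ℂ} (hQ : ∀ i, (Q i).PosSemidef)
    (hX : ∀ i, (X i).PosSemidef) (hY : ∀ i, (Y i).PosSemidef) :
    ((((r - 1) / (r + 1) : ℝ) : ℂ) • elementaryTensor (fun i => X i + ((1 + r : ℝ) : ℂ) • Q i)
      + elementaryTensor (fun i => X i + ((1 - r : ℝ) : ℂ) • Q i)
      + elementaryTensor (fun i => Y i + ((1 + r : ℝ) : ℂ) • Q i)
      - elementaryTensor (fun i => Y i + ((1 - r : ℝ) : ℂ) • Q i)).PosSemidef := by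
  simp only [elementaryTensor_add_smul]
  rw [Finset.smul_sum, ← Finset.sum_add_distrib, ← Finset.sum_add_distrib, ← Finset.sum_sub_distrib]
  refine Matrix.posSemidef_sum _ fun S _ => ?_
  have hE : ∀ Z : Fin n → Matrix A A ℂ, (∀ i, (Z i).PosSemidef) →
      (elementaryTensor fun i => if i ∈ S then Q i else Z i).PosSemidef := fun Z hZ =>
    posSemidef_elementaryTensor fun i => by split_ifs <;> [exact hQ i; exact hZ i]
  rw [smul_smul, ← add_smul, add_sub_assoc, ← sub_smul]
  refine ((hE X hX).smul ?_).add ((hE Y hY).smul ?_)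
  · exact_mod_cast one_add_pow_add_nonneg hr S.card
  · exact_mod_cast one_add_pow_sub_nonneg hr S.card

/-- The elementary tensor of matrices on `A × B`, with all the factors `A` gathered on the left. -/
def pairTensor {n : ℕ} (X : Fin n → Matrix (A × B) (A × B) ℂ) :
    Matrix ((Fin n → A) × (Fin n → B)) ((Fin n → A) × (Fin n → B)) ℂ :=
  (elementaryTensor X).submatrix (Equiv.arrowProdEquivProdArrow (Fin n) (fun _ => A) fun _ => B).symm
    (Equiv.arrowProdEquivProdArrow (Fin n) (fun _ => A) fun _ => B).symm

theorem partialTranspose_pairTensor {n : ℕ} (X : Fin n → Matrix (A × B) (A × B) ℂ) :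
    partialTranspose (pairTensor X) = pairTensor fun i => partialTranspose (X i) := rfl

theorem trace_pairTensor_mul {n : ℕ} [Fintype A] [Fintype B] [DecidableEq A] [DecidableEq B]
    (X Y : Fin n → Matrix (A × B) (A × B) ℂ) :
    (pairTensor X * pairTensor Y).trace = ∏ i, (X i * Y i).trace := by
  rw [← trace_elementaryTensor, ← elementaryTensor_mul, pairTensor, pairTensor,
    Matrix.submatrix_mul_equiv]
  exact Equiv.sum_comp (Equiv.arrowProdEquivProdArrow (Fin n) (fun _ => A) fun _ => B).symm
    (elementaryTensor X * elementaryTensor Y).diag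

/-! ### Choi matrices and duality for decomposable maps. -/

theorem choi_apply [DecidableEq A] (L : Matrix A A ℂ →ₗ[ℂ] Matrix B B ℂ) (p q : A × B) :
    choi L p q = L (Matrix.single p.1 q.1 1) p.2 q.2 := by
  have h : (Matrix.of fun a a' => maxEntangled A (p.1, a) (q.1, a')) = Matrix.single p.1 q.1 1 := by
    ext a a'
    simp only [Matrix.of_apply, maxEntangled, Matrix.vecMulVec_apply, Matrix.single_apply]
    split_ifs <;> simp_all
  rw [← h]
  rfl

theorem choi_add [DecidableEq A] (L L' : Matrix A A ℂ →ₗ[ℂ] Matrix B B ℂ) :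
    choi (L + L') = choi L + choi L' := by
  ext p q
  simp [choi_apply]

theorem choi_transposition_comp [DecidableEq A] (L : Matrix A A ℂ →ₗ[ℂ] Matrix B B ℂ) :
    choi (transposition B ∘ₗ L) = partialTranspose (choi L) := by
  ext p q
  rw [choi_apply, partialTranspose, Matrix.of_apply, choi_apply]
  rfl

theorem choi_tensorPower [Fintype A] [DecidableEq A] (n : ℕ)
    (P : Matrix A A ℂ →ₗ[ℂ] Matrix B B ℂ) :
    choi (tensorPower n P) = pairTensor fun _ => choi P := by
  ext p q
  have h : tensorPower n P (Matrix.single p.1 q.1 1)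
      = elementaryTensor fun i => P (Matrix.single (p.1 i) (q.1 i) 1) := by
    change ∑ a, ∑ a', Matrix.single p.1 q.1 (1 : ℂ) a a' • _ = _
    rw [Finset.sum_eq_single p.1, Finset.sum_eq_single q.1]
    · simp
    · intro b _ hb
      simp [hb.symm]
    · simp
    · intro b _ hb
      simp [hb.symm]
    · simp
  rw [choi_apply, h]
  simp [pairTensor, elementaryTensor, choi_apply, Equiv.arrowProdEquivProdArrow]

theorem posSemidef_maxEntangled (A : Type*) [Fintype A] [DecidableEq A] :
    (maxEntangled A).PosSemidef := by
  have h := Matrix.posSemidef_vecMulVec_self_star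
    (fun p : A × A => if p.1 = p.2 then (1 : ℂ) else 0)
  have hs : star (fun p : A × A => if p.1 = p.2 then (1 : ℂ) else 0)
      = fun p : A × A => if p.1 = p.2 then (1 : ℂ) else 0 := by
    ext p
    simp [apply_ite star]
  rwa [hs] at h

theorem IsCompletelyPositive.posSemidef_choi [Fintype A] [Fintype B] [DecidableEq A]
    {T : Matrix A A ℂ →ₗ[ℂ] Matrix B B ℂ} (hT : IsCompletelyPositive T) :
    (choi T).PosSemidef := by
  -- Complete positivity is tested on `Fin k` only, so ω is reindexed by an enumeration of A.
  let e := Fintype.equivFin A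
  have h := hT (Fintype.card A) ((maxEntangled A).submatrix (Prod.map e.symm id) (Prod.map e.symm id))
    ((posSemidef_maxEntangled A).submatrix _)
  convert h.submatrix (Prod.map e id) using 1
  ext p q
  change T _ _ _ = T _ _ _
  simp

theorem trace_mul_nonneg_of_posSemidef [Fintype A] {X Y : Matrix A A ℂ} (hX : X.PosSemidef)
    (hY : Y.PosSemidef) : 0 ≤ (X * Y).trace := by
  obtain ⟨m, v, rfl⟩ := Matrix.posSemidef_iff_eq_sum_vecMulVec.mp hX
  rw [Finset.sum_mul, Matrix.trace_sum]
  refine Finset.sum_nonneg fun i _ => ?_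
  rw [Matrix.trace_mul_comm, Matrix.mul_vecMulVec, Matrix.trace_vecMulVec, dotProduct_comm]
  exact hY.dotProduct_mulVec_nonneg (v i)

theorem IsDecomposable.trace_choi_mul_nonneg [Fintype A] [Fintype B] [DecidableEq A]
    {L : Matrix A A ℂ →ₗ[ℂ] Matrix B B ℂ} (hL : IsDecomposable L)
    {Y : Matrix (A × B) (A × B) ℂ} (hY : Y.PosSemidef) (hY' : (partialTranspose Y).PosSemidef) :
    0 ≤ (choi L * Y).trace := by
  obtain ⟨T₁, T₂, h₁, h₂, rfl⟩ := hL
  rw [choi_add, choi_transposition_comp, Matrix.add_mul, Matrix.trace_add,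
    trace_partialTranspose_mul]
  exact add_nonneg (trace_mul_nonneg_of_posSemidef h₁.posSemidef_choi hY)
    (trace_mul_nonneg_of_posSemidef h₂.posSemidef_choi hY')

theorem partialTranspose_one [DecidableEq A] [DecidableEq B] :
    partialTranspose (1 : Matrix (A × B) (A × B) ℂ) = 1 := by
  ext p q
  simp only [partialTranspose, Matrix.of_apply, Matrix.one_apply, Prod.ext_iff]
  congr 1
  simp [eq_comm (a := p.2)]

/-! ### The witness and its trace. -/

section Witness

variable {n : ℕ} [DecidableEq A] [DecidableEq B]

/-- The factors `G + σ H` on `U`, the partial transposes of `G' + τ H'` on `V`, and `1` elsewhere. -/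
def blockFactor (U V : Finset (Fin n)) (G H G' H' : Matrix (A × B) (A × B) ℂ) (σ τ : ℂ)
    (i : Fin n) : Matrix (A × B) (A × B) ℂ :=
  if i ∈ U then G + σ • H else if i ∈ V then partialTranspose (G' + τ • H') else 1

/-- A matrix with positive partial transpose which detects non-decomposability of `P^{⊗ n}`. -/
noncomputable def witness (r : ℝ) (U V : Finset (Fin n)) (G H G' H' : Matrix (A × B) (A × B) ℂ) :
    Matrix ((Fin n → A) × (Fin n → B)) ((Fin n → A) × (Fin n → B)) ℂ :=
  (((r - 1) / (r + 1) : ℝ) : ℂ) • pairTensor (blockFactor U V G H G' H' 1 1)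
    + pairTensor (blockFactor U V G H G' H' (-1) 1)
    + pairTensor (blockFactor U V G H G' H' 1 (-1))
    - pairTensor (blockFactor U V G H G' H' (-1) (-1))

theorem partialTranspose_blockFactor {U V : Finset (Fin n)} (hUV : Disjoint U V)
    (G H G' H' : Matrix (A × B) (A × B) ℂ) (σ τ : ℂ) :
    (fun i => partialTranspose (blockFactor U V G H G' H' σ τ i))
      = blockFactor V U G' H' G H τ σ := by
  ext1 i
  unfold blockFactor
  by_cases hU : i ∈ U
  · simp [hU, Finset.disjoint_left.mp hUV hU]
  · by_cases hV : i ∈ V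
    · simp [hU, hV, partialTranspose_partialTranspose]
    · simp [hU, hV, partialTranspose_one]

/-- The two middle terms trade places and the outer two are symmetric, so one positivity proof also
covers the partial transpose. -/
theorem partialTranspose_witness (r : ℝ) {U V : Finset (Fin n)} (hUV : Disjoint U V)
    (G H G' H' : Matrix (A × B) (A × B) ℂ) :
    partialTranspose (witness r U V G H G' H') = witness r V U G' H' G H := by
  simp only [witness, partialTranspose_add, partialTranspose_sub, partialTranspose_smul,
    partialTranspose_pairTensor, partialTranspose_blockFactor hUV]
  rw [add_right_comm]

theorem posSemidef_witness [Fintype A] [Fintype B] {r : ℝ} (hr : 1 ≤ r) (U V : Finset (Fin n))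
    {G H G' H' : Matrix (A × B) (A × B) ℂ} (h : IsTestPair r G H) (h' : IsTestPair r G' H') :
    (witness r U V G H G' H').PosSemidef := by
  have hr0 : r ≠ 0 := by linarith
  have hrC : (r : ℂ) ≠ 0 := by exact_mod_cast hr0
  have hr' : (0 : ℂ) ≤ (r : ℂ)⁻¹ := by
    rw [← Complex.ofReal_inv, Complex.zero_le_real]
    exact inv_nonneg.mpr (by linarith)
  -- On U, with Q = H/r and X = G - H/r, G + σH equals X + (1 + σr)Q, and both pieces are positive
  -- semidefinite.
  let Q : Fin n → Matrix (A × B) (A × B) ℂ := fun i => if i ∈ U then (r : ℂ)⁻¹ • H else 0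
  let X : ℂ → Fin n → Matrix (A × B) (A × B) ℂ := fun τ i =>
    if i ∈ U then (r : ℂ)⁻¹ • ((r : ℂ) • G - H)
    else if i ∈ V then partialTranspose (G' + τ • H') else 1
  have hX : ∀ τ, (partialTranspose (G' + τ • H')).PosSemidef → ∀ i, (X τ i).PosSemidef := by
    intro τ hτ i
    simp only [X]
    split_ifs
    · exact h.posSemidef_sub.smul hr'
    · exact hτ
    · exact .one
  have hQ : ∀ i, (Q i).PosSemidef := by
    intro i
    simp only [Q]
    split_ifs
    · exact h.posSemidef_right.smul hr'
    · exact .zero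
  have hXQ : ∀ (σ : ℝ) (τ : ℂ), (fun i => X τ i + ((1 + σ * r : ℝ) : ℂ) • Q i)
      = blockFactor U V G H G' H' σ τ := by
    intro σ τ
    ext1 i
    simp only [X, Q, blockFactor]
    split_ifs
    · rw [smul_sub, smul_smul, smul_smul, inv_mul_cancel₀ hrC, one_smul, sub_add,
        ← sub_smul, sub_eq_add_neg, ← neg_smul]
      congr 2
      push_cast
      field_simp
      ring
    · simp
    · simp
  have h1 := posSemidef_elementaryTensor_combination hr hQ
    (hX 1 (by simpa using h'.posSemidef_partialTranspose_add))
    (hX (-1) (by simpa [← sub_eq_add_neg] using h'.posSemidef_partialTranspose_sub))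
  have e1 : ∀ τ, (fun i => X τ i + ((1 + r : ℝ) : ℂ) • Q i) = blockFactor U V G H G' H' 1 τ :=
    fun τ => by simpa using hXQ 1 τ
  have e2 : ∀ τ, (fun i => X τ i + ((1 - r : ℝ) : ℂ) • Q i) = blockFactor U V G H G' H' (-1) τ :=
    fun τ => by simpa [← sub_eq_add_neg] using hXQ (-1) τ
  rw [e1, e1, e2, e2] at h1
  exact h1.submatrix _

theorem trace_mul_pairTensor_blockFactor [Fintype A] [Fintype B] {U V : Finset (Fin n)}
    (hUV : Disjoint U V) (C G H G' H' : Matrix (A × B) (A × B) ℂ) (σ τ : ℂ) :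
    (pairTensor (fun _ => C) * pairTensor (blockFactor U V G H G' H' σ τ)).trace
      = (C * (G + σ • H)).trace ^ U.card * (partialTranspose C * (G' + τ • H')).trace ^ V.card
        * C.trace ^ (U ∪ V)ᶜ.card := by
  rw [trace_pairTensor_mul, ← Finset.prod_mul_prod_compl (U ∪ V), Finset.prod_union hUV]
  congr 1
  · congr 1
    · refine Finset.prod_eq_pow_card fun i hi => ?_
      rw [blockFactor, if_pos hi]
    · refine Finset.prod_eq_pow_card fun i hi => ?_
      rw [blockFactor, if_neg (Finset.disjoint_right.mp hUV hi), if_pos hi,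
        trace_partialTranspose_mul]
  · refine Finset.prod_eq_pow_card fun i hi => ?_
    rw [Finset.mem_compl, Finset.mem_union, not_or] at hi
    rw [blockFactor, if_neg hi.1, if_neg hi.2, Matrix.mul_one]

theorem trace_mul_witness [Fintype A] [Fintype B] {r : ℝ} {U V : Finset (Fin n)}
    (hUV : Disjoint U V) {C G H G' H' : Matrix (A × B) (A × B) ℂ} {a b a' b' c : ℝ}
    (ha : (C * (G + (1 : ℂ) • H)).trace = a) (hb : (C * (G + (-1 : ℂ) • H)).trace = b)
    (ha' : (partialTranspose C * (G' + (1 : ℂ) • H')).trace = a')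
    (hb' : (partialTranspose C * (G' + (-1 : ℂ) • H')).trace = b') (hc : C.trace = c) :
    (pairTensor (fun _ => C) * witness r U V G H G' H').trace
      = ((((r - 1) / (r + 1) * (a ^ U.card * a' ^ V.card) + b ^ U.card * a' ^ V.card
        + a ^ U.card * b' ^ V.card - b ^ U.card * b' ^ V.card) * c ^ (U ∪ V)ᶜ.card : ℝ) : ℂ) := by
  rw [witness, Matrix.mul_sub, Matrix.mul_add, Matrix.mul_add, Matrix.mul_smul, Matrix.trace_sub,
    Matrix.trace_add, Matrix.trace_add, Matrix.trace_smul]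
  simp only [trace_mul_pairTensor_blockFactor hUV]
  rw [ha, hb, ha', hb', hc, smul_eq_mul]
  push_cast
  ring

end Witness

/-- If `P^{⊗ n}` is decomposable, so is `P` in the dual sense. -/
theorem IsTensorStableDecomposable.trace_choi_mul_nonneg [Fintype A] [Fintype B] [DecidableEq A]
    [DecidableEq B] {n : ℕ} (hn : n ≠ 0) {P : Matrix A A ℂ →ₗ[ℂ] Matrix B B ℂ}
    (hdec : IsTensorStableDecomposable n P) (hC : 0 < (choi P).trace)
    {Y : Matrix (A × B) (A × B) ℂ} (hY : Y.PosSemidef) (hY' : (partialTranspose Y).PosSemidef) :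
    0 ≤ (choi P * Y).trace := by
  obtain ⟨n, rfl⟩ := Nat.exists_eq_succ_of_ne_zero hn
  -- One slot holds Y; each other slot contributes a positive factor Tr C, which cancels.
  let Z : Fin (n + 1) → Matrix (A × B) (A × B) ℂ := Fin.cons Y fun _ => 1
  have h := IsDecomposable.trace_choi_mul_nonneg hdec (Y := pairTensor Z)
    ((posSemidef_elementaryTensor (X := Z)
      fun i => Fin.cases hY (fun _ => by simpa [Z] using .one) i).submatrix _)
    (by
      rw [partialTranspose_pairTensor]
      exact (posSemidef_elementaryTensor
        fun i => Fin.cases hY' (fun _ => by simpa [Z, partialTranspose_one] using .one) i).submatrix _)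
  rw [choi_tensorPower, trace_pairTensor_mul, Fin.prod_univ_succ] at h
  simp only [Z, Fin.cons_zero, Fin.cons_succ, Matrix.mul_one, Finset.prod_const] at h
  exact le_of_mul_le_mul_right (by simpa using h) (pow_pos hC _)

/-! ### From small μ to test pairs. -/

/-- With δ = (r-1)/(r+1) the left side is (1+δ) a^k a'^k - (b^k - a^k)(b'^k - a'^k), and the choice
of s makes each difference exceed √(1+δ) times a^k or a'^k. -/
theorem combination_neg {a b a' b' r s : ℝ} {k : ℕ} (hr : 1 ≤ r) (hk : k ≠ 0)
    (hs0 : 0 ≤ s) (hs : s ^ k = 1 + √(2 * r / (r + 1))) (ha : 0 ≤ a) (ha' : 0 ≤ a')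
    (hab : s * a < b) (hab' : s * a' < b') :
    (r - 1) / (r + 1) * (a ^ k * a' ^ k) + b ^ k * a' ^ k + a ^ k * b' ^ k - b ^ k * b' ^ k < 0 := by
  have key : ∀ {x y : ℝ}, 0 ≤ x → s * x < y → √(2 * r / (r + 1)) * x ^ k < y ^ k - x ^ k := by
    intro x y hx hxy
    have h := pow_lt_pow_left₀ hxy (mul_nonneg hs0 hx) hk
    rw [mul_pow, hs] at h
    linarith
  have h1 := key ha hab
  have h2 := key ha' hab'
  have h3 := mul_lt_mul'' h1 h2 (by positivity) (by positivity)
  have h4 : √(2 * r / (r + 1)) * √(2 * r / (r + 1)) = 1 + (r - 1) / (r + 1) := by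
    rw [Real.mul_self_sqrt (by positivity)]
    field_simp
    ring
  have h5 : √(2 * r / (r + 1)) * a ^ k * (√(2 * r / (r + 1)) * a' ^ k)
      = (1 + (r - 1) / (r + 1)) * (a ^ k * a' ^ k) := by
    rw [← h4]
    ring
  rw [h5] at h3
  linarith

theorem map_one_eq_partialTrace_choi [Fintype A] [DecidableEq A]
    (L : Matrix A A ℂ →ₗ[ℂ] Matrix B B ℂ) : L 1 = partialTrace (choi L) := by
  rw [map_eq_sum L]
  ext b b'
  simp [partialTrace, choi_apply, Matrix.sum_apply, Matrix.one_apply, ite_smul]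

theorem trace_mul_one_kronecker [Fintype A] [Fintype B] [DecidableEq A]
    (C : Matrix (A × B) (A × B) ℂ) (N : Matrix B B ℂ) :
    (C * ((1 : Matrix A A ℂ) ⊗ₖ N)).trace = (partialTrace C * N).trace := by
  simp only [Matrix.trace, Matrix.diag_apply, Matrix.mul_apply, Fintype.sum_prod_type,
    Matrix.kroneckerMap_apply, Matrix.one_apply, partialTrace, Matrix.of_apply, Finset.sum_mul,
    ite_mul, one_mul, zero_mul, mul_ite, mul_zero, Finset.sum_ite_irrel, Finset.sum_const_zero,
    Finset.sum_ite_eq', Finset.mem_univ, if_true]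
  rw [Finset.sum_comm]
  exact Finset.sum_congr rfl fun b _ => Finset.sum_comm

theorem exists_of_mu_lt [Fintype A] [DecidableEq A] [Fintype B]
    {L : Matrix A A ℂ →ₗ[ℂ] Matrix B B ℂ} (hL : (L 1).PosSemidef) {m : ℝ} (hm : 0 ≤ m)
    (h : mu L < ((-m : ℝ) : EReal)) :
    ∃ C : Matrix (A × B) (A × B) ℂ, C.PosSemidef ∧ (choi L * C).trace.re
        < -m * (choi L * ((1 : Matrix A A ℂ) ⊗ₖ partialTrace C)).trace.re := by
  obtain ⟨_, ⟨T, hT, -, rfl⟩, hlt⟩ := sInf_lt_iff.mp h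
  rw [EReal.coe_lt_coe_iff] at hlt
  refine ⟨choi T, hT.posSemidef_choi, ?_⟩
  have hT1 : (T 1).PosSemidef := by
    rw [map_one_eq_partialTrace_choi]
    exact posSemidef_partialTrace hT.posSemidef_choi
  have hden : ((hsAdjoint T ∘ₗ L) 1).trace = (L 1 * T 1).trace := by
    have h1 := hsAdjoint_spec T 1 (L 1)
    rw [hT1.1.eq, Matrix.conjTranspose_one, Matrix.one_mul, Matrix.trace_mul_comm] at h1
    exact h1.symm
  rw [hden] at hlt
  rw [trace_mul_one_kronecker, ← map_one_eq_partialTrace_choi, ← map_one_eq_partialTrace_choi]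
  have h0 : 0 ≤ (L 1 * T 1).trace.re :=
    (Complex.nonneg_iff.mp (trace_mul_nonneg_of_posSemidef hL hT1)).1
  -- A vanishing denominator makes the quotient 0, which is not below -m.
  rcases h0.eq_or_lt with h0 | h0
  · rw [← h0, div_zero] at hlt
    linarith
  · exact (div_lt_iff₀ h0).mp hlt

/-- With g = Tr[CG] and h = Tr[CH], C the Choi matrix of L, the bound h < -((s-1)/(1+s)) g
rearranges to s(g+h) < g-h. Positivity of the pairing makes g and g+h real, hence also h. -/
theorem exists_isTestPair_of_mu_lt [Fintype A] [DecidableEq A] [Fintype B] [DecidableEq B]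
    {L : Matrix A A ℂ →ₗ[ℂ] Matrix B B ℂ} (hL : (L 1).PosSemidef)
    (hpair : ∀ Y : Matrix (A × B) (A × B) ℂ, Y.PosSemidef → (partialTranspose Y).PosSemidef →
      0 ≤ (choi L * Y).trace) {s : ℝ} (hs : 1 ≤ s)
    (h : mu L < ((2 / (1 + s) - 1 : ℝ) : EReal)) :
    ∃ (G H : Matrix (A × B) (A × B) ℂ) (a b : ℝ),
      IsTestPair (min (Fintype.card A) (Fintype.card B) : ℕ) G H ∧
      (choi L * (G + (1 : ℂ) • H)).trace = a ∧ (choi L * (G + (-1 : ℂ) • H)).trace = b ∧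
      0 ≤ a ∧ s * a < b := by
  have hs1 : 0 < 1 + s := by linarith
  have hm : (2 / (1 + s) - 1 : ℝ) = -((s - 1) / (1 + s)) := by
    field_simp
    ring
  rw [hm] at h
  obtain ⟨H, hH, hlt⟩ := exists_of_mu_lt hL (div_nonneg (by linarith) hs1.le) h
  have ht := isTestPair_of_posSemidef hH
  generalize (1 : Matrix A A ℂ) ⊗ₖ partialTrace H = G at ht hlt
  have hG := Complex.nonneg_iff.mp
    (hpair G ht.posSemidef_left ht.posSemidef_partialTranspose_left)
  have hGH := Complex.nonneg_iff.mp (hpair (G + H) (ht.posSemidef_left.add ht.posSemidef_right)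
    ht.posSemidef_partialTranspose_add)
  rw [Matrix.mul_add, Matrix.trace_add, Complex.add_re, Complex.add_im] at hGH
  have him : (choi L * H).trace.im = 0 := by linarith [hG.2, hGH.2]
  refine ⟨G, H, (choi L * G).trace.re + (choi L * H).trace.re,
    (choi L * G).trace.re - (choi L * H).trace.re, ht, ?_, ?_, hGH.1, ?_⟩
  · rw [one_smul, Matrix.mul_add, Matrix.trace_add]
    apply Complex.ext
    · simp
    · simpa using hGH.2.symm
  · rw [neg_one_smul, ← sub_eq_add_neg, Matrix.mul_sub, Matrix.trace_sub]
    apply Complex.ext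
    · simp
    · simp [him, ← hG.2]
  · have h1 := mul_lt_mul_of_pos_left hlt hs1
    have h2 : (1 + s) * (-((s - 1) / (1 + s)) * (choi L * G).trace.re)
        = -((s - 1) * (choi L * G).trace.re) := by
      field_simp
    rw [h2] at h1
    linarith

/-! ### Nonzero positive maps have Choi matrices of positive trace. -/

theorem eq_zero_of_posSemidef_of_posSemidef_neg [Fintype A] {X : Matrix A A ℂ}
    (hX : X.PosSemidef) (hX' : (-X).PosSemidef) : X = 0 := by
  refine hX.trace_eq_zero_iff.mp (le_antisymm ?_ hX.trace_nonneg)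
  have h := hX'.trace_nonneg
  rwa [Matrix.trace_neg, neg_nonneg] at h

/-- The diagonal units have positive semidefinite images summing to 0. Testing on e_i + θ e_j then
leaves only the terms linear in θ and its conjugate; they change sign with θ, so they vanish. -/
theorem IsPositive.eq_zero_of_map_one_eq_zero [Fintype A] [DecidableEq A] [Fintype B]
    {P : Matrix A A ℂ →ₗ[ℂ] Matrix B B ℂ} (hP : IsPositive P) (h1 : P 1 = 0) : P = 0 := by
  have hdiag_pos : ∀ i, (P (Matrix.single i i 1)).PosSemidef := fun i => by
    refine hP _ ?_
    rw [← Matrix.diagonal_single]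
    exact Matrix.PosSemidef.diagonal (Pi.single_nonneg.mpr zero_le_one)
  have hdiag : ∀ i, P (Matrix.single i i 1) = 0 := by
    intro i
    rw [← (hdiag_pos i).trace_eq_zero_iff]
    have hsum : ∑ i, (P (Matrix.single i i 1)).trace = 0 := by
      rw [← Matrix.trace_sum, ← map_sum, Matrix.sum_single_one, h1, Matrix.trace_zero]
    exact (Finset.sum_eq_zero_iff_of_nonneg fun j _ => (hdiag_pos j).trace_nonneg).mp hsum i
      (Finset.mem_univ i)
  have hoff : ∀ (i j : A) (θ : ℂ),
      (star θ • P (Matrix.single i j 1) + θ • P (Matrix.single j i 1)).PosSemidef := by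
    intro i j θ
    let v : A → ℂ := Pi.single i 1 + θ • Pi.single j 1
    have hv : Matrix.vecMulVec v (star v) = Matrix.single i i 1 + (θ * star θ) • Matrix.single j j 1
        + (star θ • Matrix.single i j 1 + θ • Matrix.single j i 1) := by
      have hstar : star v = Pi.single i 1 + star θ • Pi.single j 1 := by
        simp [v]
      rw [hstar]
      simp only [v, Matrix.add_vecMulVec, Matrix.vecMulVec_add, Matrix.smul_vecMulVec,
        Matrix.vecMulVec_smul, Matrix.single_eq_single_vecMulVec_single, smul_add, smul_smul, mul_comm (star θ) θ]
      abel
    have h := hP _ (Matrix.posSemidef_vecMulVec_self_star v)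
    rw [hv] at h
    rwa [map_add, map_add, map_add, map_smul, map_smul, map_smul, hdiag, hdiag, smul_zero, add_zero,
      zero_add] at h
  have hzero : ∀ (i j : A) (θ : ℂ),
      star θ • P (Matrix.single i j 1) + θ • P (Matrix.single j i 1) = 0 := by
    intro i j θ
    refine eq_zero_of_posSemidef_of_posSemidef_neg (hoff i j θ) ?_
    convert hoff i j (-θ) using 1
    rw [star_neg, neg_smul, neg_smul, neg_add]
  ext1 X
  rw [map_eq_sum P X]
  refine Finset.sum_eq_zero fun i _ => Finset.sum_eq_zero fun j _ => ?_
  -- The values θ = 1 and θ = i give the sum and the difference of the images of E_ij and E_ji.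
  have h2 := hzero i j 1
  have h3 := congrArg (Complex.I • ·) (hzero i j Complex.I)
  simp only [smul_add, smul_smul, smul_zero, star_one, one_smul] at h2 h3
  rw [show star Complex.I = -Complex.I from Complex.conj_I, mul_neg, Complex.I_mul_I, neg_neg,
    one_smul, neg_one_smul] at h3
  have h4 : (2 : ℂ) • P (Matrix.single i j 1) = 0 := by
    rw [two_smul, ← add_zero (0 : Matrix B B ℂ)]
    nth_rewrite 1 [← h2]
    rw [← h3]
    abel
  rw [(smul_eq_zero.mp h4).resolve_left two_ne_zero, smul_zero]

theorem trace_choi [Fintype A] [DecidableEq A] [Fintype B] (L : Matrix A A ℂ →ₗ[ℂ] Matrix B B ℂ) :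
    (choi L).trace = (L 1).trace := by
  rw [map_one_eq_partialTrace_choi]
  simp only [Matrix.trace, Matrix.diag_apply, Fintype.sum_prod_type, partialTrace, Matrix.of_apply]
  exact Finset.sum_comm

theorem IsPositive.trace_choi_pos [Fintype A] [DecidableEq A] [Fintype B]
    {P : Matrix A A ℂ →ₗ[ℂ] Matrix B B ℂ} (hP : IsPositive P) (hP0 : P ≠ 0) :
    0 < (choi P).trace := by
  have h1 : (P 1).PosSemidef := hP 1 .one
  rw [trace_choi]
  refine h1.trace_nonneg.lt_of_ne fun h => hP0 (hP.eq_zero_of_map_one_eq_zero ?_)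
  exact h1.trace_eq_zero_iff.mp h.symm

end TensorStable

/-! ### The main theorem. -/

open TensorStable in
theorem theorem2 (dA dB n : ℕ) (hn : 2 ≤ n)
    (P : Matrix (Fin dA) (Fin dA) ℂ →ₗ[ℂ] Matrix (Fin dB) (Fin dB) ℂ)
    (hP0 : P ≠ 0) (hP : TensorStable.IsPositive P)
    (hdec : TensorStable.IsTensorStableDecomposable n P)
    (d : ℕ) (hd : d = min dA dB) :
    ((2 / (1 + (1 + Real.sqrt (2 * (d : ℝ) / ((d : ℝ) + 1))) ^ (1 / ((n / 2 : ℕ) : ℝ))) - 1 : ℝ)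
        : EReal)
      ≤ max (TensorStable.mu P)
          (TensorStable.mu (TensorStable.transposition (Fin dB) ∘ₗ P)) := by
  have hd1 : (1 : ℝ) ≤ d := by
    rw [Nat.one_le_cast, hd, Nat.one_le_iff_ne_zero]
    intro h0
    refine hP0 (LinearMap.ext fun X => ?_)
    rcases Nat.min_eq_zero_iff.mp h0 with rfl | rfl
    · rw [Subsingleton.elim X 0, map_zero, map_zero]
    · exact Subsingleton.elim _ _
  have hk : n / 2 ≠ 0 := by omega
  have hC := hP.trace_choi_pos hP0
  have hpair : ∀ Y : Matrix (Fin dA × Fin dB) (Fin dA × Fin dB) ℂ, Y.PosSemidef →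
      (partialTranspose Y).PosSemidef → 0 ≤ (choi P * Y).trace := fun Y hY hY' =>
    hdec.trace_choi_mul_nonneg (by omega) hC hY hY'
  by_contra! hlt
  rw [max_lt_iff] at hlt
  set s : ℝ := (1 + √(2 * (d : ℝ) / ((d : ℝ) + 1))) ^ (1 / ((n / 2 : ℕ) : ℝ)) with hs
  have hs1 : 1 ≤ s := Real.one_le_rpow (by linarith [Real.sqrt_nonneg (2 * (d : ℝ) / (d + 1))])
    (by positivity)
  have hsk : s ^ (n / 2) = 1 + √(2 * (d : ℝ) / (d + 1)) := by
    rw [hs, one_div, Real.rpow_inv_natCast_pow (by positivity) hk]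
  obtain ⟨G, H, a, b, ht, hga, hgb, ha, hab⟩ :=
    exists_isTestPair_of_mu_lt (hP 1 .one) hpair hs1 hlt.1
  obtain ⟨G', H', a', b', ht', hga', hgb', ha', hab'⟩ :=
    exists_isTestPair_of_mu_lt (L := transposition (Fin dB) ∘ₗ P) (hP 1 .one).transpose
      -- The matrices positive semidefinite together with their partial transpose are stable under
      -- Γ, so the pairing for P yields that for ϑ ∘ P.
      (fun Y hY hY' => by
        rw [choi_transposition_comp, trace_partialTranspose_mul]
        exact hpair _ hY' hY) hs1 hlt.2
  rw [choi_transposition_comp] at hga' hgb'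
  rw [Fintype.card_fin, Fintype.card_fin, ← hd] at ht ht'
  obtain ⟨U, -, hU⟩ := Finset.exists_subset_card_eq (s := (Finset.univ : Finset (Fin n)))
    (n := n / 2) (by rw [Finset.card_univ, Fintype.card_fin]; omega)
  obtain ⟨V, hVU, hV⟩ := Finset.exists_subset_card_eq (s := Uᶜ) (n := n / 2)
    (by rw [Finset.card_compl, Fintype.card_fin]; omega)
  have hUV : Disjoint U V := (Finset.subset_compl_iff_disjoint_left.mp hVU)
  have hnonneg := IsDecomposable.trace_choi_mul_nonneg hdec (posSemidef_witness hd1 U V ht ht')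
    (by rw [partialTranspose_witness _ hUV]; exact posSemidef_witness hd1 V U ht' ht)
  obtain ⟨c, hc, hcC⟩ : ∃ c : ℝ, 0 < c ∧ (choi P).trace = c := by
    obtain ⟨h1, h2⟩ := Complex.pos_iff.mp hC
    exact ⟨_, h1, Complex.ext rfl (by simpa using h2.symm)⟩
  rw [choi_tensorPower, trace_mul_witness hUV hga hgb hga' hgb' hcC, Complex.zero_le_real, hU,
    hV] at hnonneg
  exact hnonneg.not_gt (mul_neg_of_neg_of_pos
    (combination_neg hd1 hk (by linarith) hsk ha ha' hab hab') (pow_pos hc _))
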